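/- For real $v$ let $W^*_v$ be the set of $z\in\mathbb{C}$ such that $|z-p/q|<|q|^{-(v+1)}$ for infinitely many pairs $(p,q)$ of Gaussian integers with $q\neq 0$ (the fractions $p/q$ need not be in lowest terms), and let $$E^*_v=\Big\{z\in\mathbb{C} : \text{for every } K>0 \text{ there are } p,q\in\mathbb{Z}[i],\ q\neq 0, \text{ with } \Big|z-\frac pq\Big|<\frac{K}{|q|^{v+1}}\Big\},\qquad E^*=\bigcap_{v>1}E^*_v .$$ Then: 1. For all $v>0$ and $\varepsilon>0$, $W^*_{v+\varepsilon}\subseteq E^*_v\subseteq W^*_v$. 2. For all $v\ge 1$, $\dim_{\mathrm H}E^*_v=\dfrac{4}{v+1}$. 3. $E^*$ is the complement of the set of $z\in\mathbb{C}$ that are of complex Diophantine type $(K,v)$ for some $K,v>0$, i.e. for which there are $K,v>0$ with $|z-p/q|\ge K/|q|^{v+1}$ for all $p,q\in\mathbb{Z}[i]$, $q\ne0$. Moreover $E^*$ is the exceptional set for the small-denominator condition of the equation $\alpha\,\partial f/\partial t+\beta\,\partial f/\partial z=g$: for all non-zero $\alpha,\beta\in\mathbb{C}$, $\beta/\alpha\in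 E^*$ if and only if there are no $K,v>0$ such that $$\Big|\frac{\beta}{\alpha}(a+ib)+(c+id)\Big|\ge K\max\{|a|,|b|,|c|,|d|\}^{-v}\quad\text{for all }(a,b,c,d)\in\mathbb{Z}^4\setminus\{0\}.$$ 4. $\dim_{\mathrm H}E^*=\lim_{v\to\infty}\dim_{\mathrm H}E^*_v=0$. -/

import Mathlib

open Filter Topology

/-- `W*_v`: the complex numbers `z` for which `|z - p/q| < 1/|q|^(v+1)` has infinitely many
solutions in pairs `(p, q)` of Gaussian integers with `q ≠ 0`. The fractions `p/q` need not be in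
lowest terms, so solutions are counted as pairs. -/
def approxSet (v : ℝ) : Set ℂ :=
  {z | {pq : GaussianInt × GaussianInt | pq.2 ≠ 0 ∧
    ‖z - (pq.1 : ℂ) / (pq.2 : ℂ)‖ < 1 / ‖(pq.2 : ℂ)‖ ^ (v + 1)}.Infinite}

/-- `E*_v`: the complex numbers `z` such that for every `K > 0` some Gaussian integers `p, q`,
`q ≠ 0`, satisfy `|z - p/q| < K/|q|^(v+1)`. -/
def excSet (v : ℝ) : Set ℂ :=
  {z | ∀ K : ℝ, 0 < K → ∃ p q : GaussianInt, q ≠ 0 ∧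
    ‖z - (p : ℂ) / (q : ℂ)‖ < K / ‖(q : ℂ)‖ ^ (v + 1)}

/-- `E* = ⋂_{v > 1} E*_v`. -/
def excSetAll : Set ℂ := ⋂ v ∈ Set.Ioi (1 : ℝ), excSet v

/-- `z` is of complex Diophantine type `(K, v)`. -/
def IsDiophantineType (K v : ℝ) (z : ℂ) : Prop :=
  ∀ p q : GaussianInt, q ≠ 0 → K / ‖(q : ℂ)‖ ^ (v + 1) ≤ ‖z - (p : ℂ) / (q : ℂ)‖

/-- The small-denominator condition with constants `K, v` for the equation
`α ∂f/∂t + β ∂f/∂z = g`: for all integers `a, b, c, d`, not all zero,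
`|(β/α)(a + ib) + (c + id)| ≥ K max(|a|,|b|,|c|,|d|)^(-v)`. -/
def SmallDenominatorCondition (α β : ℂ) (K v : ℝ) : Prop :=
  ∀ a b c d : ℤ, ¬(a = 0 ∧ b = 0 ∧ c = 0 ∧ d = 0) →
    K * ((max (max |a| |b|) (max |c| |d|) : ℤ) : ℝ) ^ (-v) ≤
      ‖β / α * ((a : ℂ) + Complex.I * (b : ℂ)) + ((c : ℂ) + Complex.I * (d : ℂ))‖

/-! Nonzero Gaussian integers have modulus at least 1 and bounded sets of them are finite. The
inclusions follow: infinitely many solutions force unbounded denominators, and then ‖q‖^(-ε) beats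
any K; conversely, finitely many solutions leave a positive minimal error unless z is itself a
fraction, which has infinitely many representations. The small-denominator condition becomes
Diophantine type on putting q = a + ib and p = -(c + id).

Upper bound for the dimension: the discs of radius ‖q‖^(-(v+1)) around the fractions p/q with ‖q‖
large cover the bounded parts of `excSet v`, and their diameters have a convergent sum of s-th
powers when (v+1)s > 4 (`hausdorffMeasure_excSet_inter_ball_ne_top`).

Lower bound: if (v+1)s < 4, no countable family U of small total weight ∑ dᵢ^s covers `excSet v`
(`exists_mem_excSet_forall_notMem`). Call a disc of radius r good if the members of U meeting it
weigh at most η r^s. Dirichlet's theorem and an area count put about n⁴r² well-separated fractions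
with ‖q‖ ≤ 2n in a disc (`exists_many_fractions`). Averaging over discs of radius n^(-t) around
them, with v+1 < t < 4/s, yields a good one inside any good disc (`exists_fraction_ballLoad_le`).
Nested good discs shrink to a point that is very well approximable and lies in no Uᵢ. -/

/-! ### Gaussian integers: discreteness and convergent sums -/

theorem GaussianInt.one_le_norm {q : GaussianInt} (hq : q ≠ 0) : 1 ≤ ‖(q : ℂ)‖ := by
  have h1 : (1 : ℝ) ≤ (q.norm : ℝ) := by exact_mod_cast GaussianInt.norm_pos.mpr hq
  rw [GaussianInt.intCast_real_norm, Complex.normSq_eq_norm_sq] at h1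
  nlinarith [_root_.norm_nonneg (q : ℂ)]

theorem GaussianInt.finite_norm_le (R : ℝ) : {q : GaussianInt | ‖(q : ℂ)‖ ≤ R}.Finite := by
  have hinj : Function.Injective fun q : GaussianInt => (q.re, q.im) := by
    intro a b h
    simp only [Prod.mk.injEq] at h
    exact Zsqrtd.ext h.1 h.2
  refine Set.Finite.subset (((Set.finite_Icc (-⌈R⌉) ⌈R⌉).prod
    (Set.finite_Icc (-⌈R⌉) ⌈R⌉)).preimage hinj.injOn) ?_
  intro q hq
  have hq : ‖(q : ℂ)‖ ≤ R := hq
  have h1 := (Complex.abs_re_le_norm (q : ℂ)).trans (hq.trans (Int.le_ceil R))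
  have h2 := (Complex.abs_im_le_norm (q : ℂ)).trans (hq.trans (Int.le_ceil R))
  rw [← GaussianInt.intCast_re] at h1
  rw [← GaussianInt.intCast_im] at h2
  have h1 : |q.re| ≤ ⌈R⌉ := by exact_mod_cast h1
  have h2 : |q.im| ≤ ⌈R⌉ := by exact_mod_cast h2
  exact ⟨abs_le.mp h1, abs_le.mp h2⟩

theorem GaussianInt.summable_norm_rpow {b : ℝ} (hb : 2 < b) :
    Summable fun q : GaussianInt => ‖(q : ℂ)‖ ^ (-b) := by
  have hinj : Function.Injective fun q : GaussianInt => (![q.re, q.im] : Fin 2 → ℤ) := by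
    intro x y h
    exact Zsqrtd.ext (congrFun h 0) (congrFun h 1)
  have hs := (EisensteinSeries.summable_one_div_norm_rpow hb).comp_injective hinj
  refine Summable.of_nonneg_of_le (fun q => by positivity) (fun q => ?_) hs
  by_cases hq : q = 0
  · subst hq
    -- By convention `0 ^ (-b) = 0` for b ≠ 0, so the term at zero is harmless.
    simp [Real.zero_rpow (by linarith : -b ≠ 0)]
    positivity
  · have hpos : 0 < ‖(![q.re, q.im] : Fin 2 → ℤ)‖ := by
      rw [norm_pos_iff]
      intro h
      exact hq (Zsqrtd.ext (congrFun h 0) (congrFun h 1))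
    refine Real.rpow_le_rpow_of_nonpos hpos ?_ (by linarith)
    refine (pi_norm_le_iff_of_nonneg (_root_.norm_nonneg _)).mpr fun i => ?_
    fin_cases i
    · simpa [Int.norm_eq_abs] using Complex.abs_re_le_norm (q : ℂ)
    · simpa [Int.norm_eq_abs] using Complex.abs_im_le_norm (q : ℂ)

/-- The shift by 1 serves the sum over numerators, where p = 0 must contribute a positive term. -/
theorem GaussianInt.summable_norm_add_one_rpow {b : ℝ} (hb : 2 < b) :
    Summable fun q : GaussianInt => (‖(q : ℂ)‖ + 1) ^ (-b) := by
  refine (GaussianInt.summable_norm_rpow hb).of_norm_bounded_eventually ?_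
  refine (Set.finite_singleton (0 : GaussianInt)).subset fun q hq => ?_
  by_contra h0
  have h1 := GaussianInt.one_le_norm (q := q) h0
  apply hq
  change ‖(‖(q : ℂ)‖ + 1) ^ (-b)‖ ≤ ‖(q : ℂ)‖ ^ (-b)
  rw [Real.norm_of_nonneg (by positivity)]
  exact Real.rpow_le_rpow_of_nonpos (by linarith) (by linarith) (by linarith)

/-! ### Comparison of `approxSet` and `excSet` -/

/-- Only finitely many fractions with bounded denominator lie within distance `1` of `z`. -/
theorem finite_pairs_of_bounded_denominator (z : ℂ) (R : ℝ) :
    {pq : GaussianInt × GaussianInt | pq.2 ≠ 0 ∧ ‖(pq.2 : ℂ)‖ ≤ R ∧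
      ‖z - (pq.1 : ℂ) / (pq.2 : ℂ)‖ < 1}.Finite := by
  refine ((GaussianInt.finite_norm_le (R * (‖z‖ + 1))).prod
    (GaussianInt.finite_norm_le R)).subset ?_
  rintro ⟨p, q⟩ ⟨hq, hR, hz⟩
  refine ⟨?_, hR⟩
  have hq1 := GaussianInt.one_le_norm hq
  have hq0 : (q : ℂ) ≠ 0 := norm_pos_iff.mp (by linarith)
  have h1 : ‖(p : ℂ) / q‖ ≤ ‖z‖ + 1 := by
    have := norm_sub_norm_le ((p : ℂ) / q) z
    rw [norm_sub_rev] at this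
    dsimp only at hz
    linarith
  rw [norm_div, div_le_iff₀ (by linarith)] at h1
  show ‖(p : ℂ)‖ ≤ R * (‖z‖ + 1)
  dsimp only at hR
  nlinarith [norm_nonneg z]

theorem exists_large_denominator {v : ℝ} (hv : 0 < v) {z : ℂ} (hz : z ∈ approxSet v) (R : ℝ) :
    ∃ p q : GaussianInt, q ≠ 0 ∧ R < ‖(q : ℂ)‖ ∧
      ‖z - (p : ℂ) / (q : ℂ)‖ < 1 / ‖(q : ℂ)‖ ^ (v + 1) := by
  obtain ⟨⟨p, q⟩, ⟨h1, h2⟩, h3⟩ :=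
    (Set.Infinite.sdiff hz (finite_pairs_of_bounded_denominator z R)).nonempty
  refine ⟨p, q, h1, ?_, h2⟩
  by_contra! hR
  refine h3 ⟨h1, hR, h2.trans_le ?_⟩
  have hq1 := GaussianInt.one_le_norm h1
  exact div_le_one_of_le₀ (Real.one_le_rpow hq1 (by linarith)) (by positivity)

theorem approxSet_subset_excSet {v ε : ℝ} (hv : 0 < v) (hε : 0 < ε) :
    approxSet (v + ε) ⊆ excSet v := by
  intro z hz K hK
  have hT : ∀ᶠ R : ℝ in atTop, R ^ (-ε) < K :=
    (tendsto_rpow_neg_atTop hε).eventually_lt_const hK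
  obtain ⟨R, hR⟩ := hT.exists_forall_of_atTop
  obtain ⟨p, q, hq, hRq, hlt⟩ := exists_large_denominator (by linarith : 0 < v + ε) hz R
  refine ⟨p, q, hq, hlt.trans ?_⟩
  have hq1 := GaussianInt.one_le_norm hq
  have hq0 : 0 < ‖(q : ℂ)‖ := by linarith
  have h := hR _ hRq.le
  rw [show v + ε + 1 = ε + (v + 1) by ring, Real.rpow_add hq0, one_div, mul_inv,
    ← Real.rpow_neg hq0.le ε, ← div_eq_mul_inv]
  gcongr

theorem excSet_subset_approxSet (v : ℝ) : excSet v ⊆ approxSet v := by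
  intro z hz
  by_cases hrat : ∃ p q : GaussianInt, q ≠ 0 ∧ z = (p : ℂ) / q
  · obtain ⟨p, q, hq, rfl⟩ := hrat
    -- Solutions are counted as pairs, so the multiples ((n+1)p, (n+1)q) of one exact representation
    -- already give infinitely many.
    refine Set.infinite_of_injective_forall_mem
      (f := fun n : ℕ => (((n + 1 : ℕ) : GaussianInt) * p, ((n + 1 : ℕ) : GaussianInt) * q)) ?_ ?_
    · intro a b hab
      have := mul_right_cancel₀ hq (Prod.ext_iff.mp hab).2
      have h2 : a + 1 = b + 1 := by exact_mod_cast this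
      omega
    · intro n
      have hn : ((n + 1 : ℕ) : GaussianInt) ≠ 0 := Nat.cast_ne_zero.mpr (Nat.succ_ne_zero n)
      have hne : ((n + 1 : ℕ) : GaussianInt) * q ≠ 0 := mul_ne_zero hn hq
      have hn' : ((((n + 1 : ℕ) : GaussianInt)) : ℂ) ≠ 0 := by
        simpa only [ne_eq, GaussianInt.toComplex_eq_zero] using hn
      refine ⟨hne, ?_⟩
      have hpos := GaussianInt.one_le_norm hne
      dsimp only
      have h0 : ((p : ℂ) / q) - ((((n + 1 : ℕ) : GaussianInt) * p : GaussianInt) : ℂ) /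
          ((((n + 1 : ℕ) : GaussianInt) * q : GaussianInt) : ℂ) = 0 := by
        rw [GaussianInt.toComplex_mul, GaussianInt.toComplex_mul, mul_div_mul_left _ _ hn', sub_self]
      rw [h0, norm_zero]
      positivity
  · push Not at hrat
    intro hfin
    have hpos : ∀ pq ∈ {pq : GaussianInt × GaussianInt | pq.2 ≠ 0 ∧
        ‖z - (pq.1 : ℂ) / (pq.2 : ℂ)‖ < 1 / ‖(pq.2 : ℂ)‖ ^ (v + 1)},
        ∃ K > 0, K ≤ ‖z - (pq.1 : ℂ) / (pq.2 : ℂ)‖ * ‖(pq.2 : ℂ)‖ ^ (v + 1) := by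
      rintro ⟨p, q⟩ ⟨hq, -⟩
      have hq1 := GaussianInt.one_le_norm hq
      have : 0 < ‖z - (p : ℂ) / q‖ := norm_pos_iff.mpr (sub_ne_zero.mpr (hrat p q hq))
      exact ⟨_, by positivity, le_rfl⟩
    choose! κ hκ0 hκ using hpos
    -- With K ≤ 1, a solution for K is one of the finitely many solutions, yet K lies below the
    -- scaled error of each.
    have hK : ∃ K > 0, K ≤ 1 ∧ ∀ pq ∈ hfin.toFinset, K ≤ κ pq := by
      have hev : ∀ᶠ K : ℝ in 𝓝[>] 0, K ≤ 1 ∧ ∀ pq ∈ hfin.toFinset, K ≤ κ pq := by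
        refine Filter.Eventually.and (Filter.mem_of_superset (Ioc_mem_nhdsGT one_pos)
          fun x hx => hx.2) ?_
        rw [Filter.eventually_all_finset]
        intro pq hpq
        exact Filter.mem_of_superset (Ioc_mem_nhdsGT (hκ0 pq (hfin.mem_toFinset.mp hpq)))
          fun x hx => hx.2
      obtain ⟨K, hK, hK0⟩ := (hev.and self_mem_nhdsWithin).exists
      exact ⟨K, hK0, hK⟩
    obtain ⟨K, hK0, hK1, hKκ⟩ := hK
    obtain ⟨p, q, hq, hlt⟩ := hz K hK0
    have hq1 := GaussianInt.one_le_norm hq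
    have hmem : (p, q) ∈ {pq : GaussianInt × GaussianInt | pq.2 ≠ 0 ∧
        ‖z - (pq.1 : ℂ) / (pq.2 : ℂ)‖ < 1 / ‖(pq.2 : ℂ)‖ ^ (v + 1)} :=
      ⟨hq, hlt.trans_le (by gcongr)⟩
    have h1 := (hKκ _ (hfin.mem_toFinset.mpr hmem)).trans (hκ _ hmem)
    rw [lt_div_iff₀ (by positivity)] at hlt
    exact absurd hlt (not_lt.mpr h1)

/-! ### Diophantine type and small denominators -/

/-- Since ‖q‖ ≥ 1, raising v weakens the type condition, so every v > 0 can be moved into the range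
v > 1. -/
theorem excSetAll_eq_compl :
    excSetAll = {z : ℂ | ∃ K > 0, ∃ v > 0, IsDiophantineType K v z}ᶜ := by
  ext z
  simp only [excSetAll, Set.mem_iInter, Set.mem_Ioi, Set.mem_compl_iff, Set.mem_ofPred_eq,
    IsDiophantineType, excSet]
  constructor
  · rintro h ⟨K, hK, v, hv, hD⟩
    obtain ⟨p, q, hq, hlt⟩ := h (v + 1) (by linarith) K hK
    have hq1 := GaussianInt.one_le_norm hq
    refine absurd (hlt.trans_le ?_) (not_lt.mpr (hD p q hq))
    gcongr
    linarith
  · intro h v hv K hK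
    by_contra! hcon
    exact h ⟨K, hK, v, by linarith, hcon⟩

theorem GaussianInt.toComplex_eq_re_add_I_mul_im (q : GaussianInt) :
    (q : ℂ) = (q.re : ℂ) + Complex.I * (q.im : ℂ) := by
  rw [GaussianInt.toComplex_def, mul_comm Complex.I]

theorem GaussianInt.norm_le_two_mul_max (a b : ℤ) :
    ‖(a : ℂ) + Complex.I * (b : ℂ)‖ ≤ 2 * ((max |a| |b| : ℤ) : ℝ) := by
  have h1 : |(a : ℝ)| ≤ ((max |a| |b| : ℤ) : ℝ) := by exact_mod_cast le_max_left |a| |b|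
  have h2 : |(b : ℝ)| ≤ ((max |a| |b| : ℤ) : ℝ) := by exact_mod_cast le_max_right |a| |b|
  calc _ ≤ ‖(a : ℂ)‖ + ‖Complex.I * (b : ℂ)‖ := norm_add_le _ _
    _ = |(a : ℝ)| + |(b : ℝ)| := by simp
    _ ≤ _ := by linarith

theorem not_smallDenominatorCondition {α β : ℂ} (h : β / α ∈ excSetAll) {K v : ℝ} (hK : 0 < K)
    (hv : 0 < v) : ¬ SmallDenominatorCondition α β K v := by
  intro hS
  set z := β / α with hz
  simp only [excSetAll, Set.mem_iInter, Set.mem_Ioi] at h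
  set A := ‖z‖ + 1 with hA
  have hA1 : 1 ≤ A := by simp [hA]
  -- The entry 1 of the minimum gives ‖zq - p‖ ≤ 1, hence ‖p‖ ≤ A‖q‖; the other entry contradicts
  -- the lower bound once the maximum is at most A‖q‖.
  obtain ⟨p, q, hq, hlt⟩ := h (v + 1) (by linarith) (min 1 (K * A ^ (-v))) (by positivity)
  have hq1 := GaussianInt.one_le_norm hq
  have hq0 : (q : ℂ) ≠ 0 := norm_pos_iff.mp (by linarith)
  have hqpos : 0 < ‖(q : ℂ)‖ := by linarith
  have heq : ‖z * q - p‖ = ‖z - (p : ℂ) / q‖ * ‖(q : ℂ)‖ := by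
    rw [← norm_mul, sub_mul, div_mul_cancel₀ _ hq0]
  have hlt2 : ‖z * q - p‖ < min 1 (K * A ^ (-v)) / ‖(q : ℂ)‖ ^ (v + 1) := by
    rw [lt_div_iff₀ (by positivity)] at hlt
    rw [heq, lt_div_iff₀ (by positivity), mul_assoc]
    have : ‖(q : ℂ)‖ * ‖(q : ℂ)‖ ^ (v + 1) = ‖(q : ℂ)‖ ^ (v + 1 + 1) := by
      rw [Real.rpow_add_one hqpos.ne' (v + 1), mul_comm]
    rwa [this]
  have hp : ‖(p : ℂ)‖ ≤ A * ‖(q : ℂ)‖ := by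
    have h1 : ‖z * q - p‖ ≤ 1 := hlt2.le.trans
      (div_le_one_of_le₀ ((min_le_left _ _).trans (Real.one_le_rpow hq1 (by linarith)))
        (by positivity))
    have h2 := norm_sub_norm_le (p : ℂ) (z * q)
    rw [norm_sub_rev, norm_mul] at h2
    rw [hA]; nlinarith
  have hqA : ‖(q : ℂ)‖ ≤ A * ‖(q : ℂ)‖ := by nlinarith
  have hne : ¬(q.re = 0 ∧ q.im = 0 ∧ (-p).re = 0 ∧ (-p).im = 0) := fun h0 =>
    hq (Zsqrtd.ext h0.1 h0.2.1)
  have hSD := hS q.re q.im (-p).re (-p).im hne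
  rw [← GaussianInt.toComplex_eq_re_add_I_mul_im, ← GaussianInt.toComplex_eq_re_add_I_mul_im, ← hz,
    GaussianInt.toComplex_neg, ← sub_eq_add_neg] at hSD
  have hmax : ((max (max |q.re| |q.im|) (max |(-p).re| |(-p).im|) : ℤ) : ℝ) ≤ A * ‖(q : ℂ)‖ := by
    push_cast
    refine max_le (max_le ?_ ?_) (max_le ?_ ?_)
    · rw [GaussianInt.intCast_re]; exact (Complex.abs_re_le_norm _).trans hqA
    · rw [GaussianInt.intCast_im]; exact (Complex.abs_im_le_norm _).trans hqA
    · rw [GaussianInt.intCast_re, GaussianInt.toComplex_neg]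
      exact (Complex.abs_re_le_norm _).trans (by rwa [norm_neg])
    · rw [GaussianInt.intCast_im, GaussianInt.toComplex_neg]
      exact (Complex.abs_im_le_norm _).trans (by rwa [norm_neg])
  have hmax0 : (0 : ℝ) < ((max (max |q.re| |q.im|) (max |(-p).re| |(-p).im|) : ℤ) : ℝ) := by
    have : 0 < max (max |q.re| |q.im|) (max |(-p).re| |(-p).im|) := by
      by_contra! hc
      simp only [max_le_iff, abs_nonpos_iff] at hc
      exact hne ⟨hc.1.1, hc.1.2, hc.2.1, hc.2.2⟩
    exact_mod_cast this
  have hge : K * A ^ (-v) * ‖(q : ℂ)‖ ^ (-v) ≤ ‖z * q - p‖ := by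
    refine le_trans ?_ hSD
    rw [mul_assoc, ← Real.mul_rpow (by positivity) (by positivity)]
    exact mul_le_mul_of_nonneg_left
      (Real.rpow_le_rpow_of_nonpos hmax0 hmax (by linarith)) hK.le
  have hfin : min 1 (K * A ^ (-v)) / ‖(q : ℂ)‖ ^ (v + 1) ≤ K * A ^ (-v) * ‖(q : ℂ)‖ ^ (-v) := by
    rw [Real.rpow_neg hqpos.le, ← div_eq_mul_inv]
    gcongr
    · exact min_le_right _ _
    · linarith
  linarith

/-- In the constant, 1 handles a + ib = 0, where only |c + id| ≥ 1 is available; the factor 2^(-v)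
comes from |a + ib| ≤ 2m. -/
theorem IsDiophantineType.smallDenominatorCondition {α β : ℂ} {K v : ℝ} (hK : 0 < K) (hv : 0 < v)
    (h : IsDiophantineType K v (β / α)) :
    SmallDenominatorCondition α β (min 1 (K * 2 ^ (-v))) v := by
  intro a b c d hne
  set m : ℤ := max (max |a| |b|) (max |c| |d|) with hm
  have hm1 : 1 ≤ m := by
    by_contra! hc
    have hc : m ≤ 0 := by omega
    simp only [hm, max_le_iff, abs_nonpos_iff] at hc
    exact hne ⟨hc.1.1, hc.1.2, hc.2.1, hc.2.2⟩
  have hm1' : (1 : ℝ) ≤ m := by exact_mod_cast hm1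
  have hmv : (m : ℝ) ^ (-v) ≤ 1 := Real.rpow_le_one_of_one_le_of_nonpos hm1' (by linarith)
  have hca : (a : ℂ) + Complex.I * b = ((⟨a, b⟩ : GaussianInt) : ℂ) := by
    rw [GaussianInt.toComplex_eq_re_add_I_mul_im]
  have hcd : (c : ℂ) + Complex.I * d = -((-(⟨c, d⟩ : GaussianInt) : GaussianInt) : ℂ) := by
    rw [GaussianInt.toComplex_neg, neg_neg, GaussianInt.toComplex_eq_re_add_I_mul_im]
  by_cases hq : (⟨a, b⟩ : GaussianInt) = 0
  · have hp : (⟨c, d⟩ : GaussianInt) ≠ 0 := by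
      intro hp
      rw [Zsqrtd.ext_iff] at hp hq
      exact hne ⟨hq.1, hq.2, hp.1, hp.2⟩
    have hp1 := GaussianInt.one_le_norm hp
    rw [hca, hq, hcd, GaussianInt.toComplex_zero, mul_zero, zero_add, GaussianInt.toComplex_neg,
      neg_neg]
    refine le_trans ?_ hp1
    exact mul_le_one₀ (min_le_left _ _) (by positivity) hmv
  · have hq1 := GaussianInt.one_le_norm hq
    have hle := h (-⟨c, d⟩) ⟨a, b⟩ hq
    have hq2 : ‖((⟨a, b⟩ : GaussianInt) : ℂ)‖ ≤ 2 * (m : ℝ) := by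
      rw [← hca]
      refine (GaussianInt.norm_le_two_mul_max a b).trans ?_
      have : max |a| |b| ≤ m := le_max_left _ _
      have : ((max |a| |b| : ℤ) : ℝ) ≤ m := by exact_mod_cast this
      linarith
    rw [hca, hcd, ← sub_eq_add_neg]
    generalize (⟨a, b⟩ : GaussianInt) = q at *
    generalize (-(⟨c, d⟩ : GaussianInt)) = p at *
    have hqpos : 0 < ‖(q : ℂ)‖ := by linarith
    have hq0 : (q : ℂ) ≠ 0 := norm_pos_iff.mp hqpos
    have heq : ‖β / α * q - p‖ = ‖β / α - (p : ℂ) / q‖ * ‖(q : ℂ)‖ := by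
      rw [← norm_mul, sub_mul, div_mul_cancel₀ _ hq0]
    rw [heq]
    calc min 1 (K * 2 ^ (-v)) * (m : ℝ) ^ (-v) ≤ K * 2 ^ (-v) * (m : ℝ) ^ (-v) := by
          gcongr; exact min_le_right _ _
      _ = K * (2 * (m : ℝ)) ^ (-v) := by
          rw [Real.mul_rpow (by norm_num) (by linarith), mul_assoc]
      _ ≤ K * ‖(q : ℂ)‖ ^ (-v) := mul_le_mul_of_nonneg_left
          (Real.rpow_le_rpow_of_nonpos hqpos hq2 (by linarith)) hK.le
      _ = K / ‖(q : ℂ)‖ ^ (v + 1) * ‖(q : ℂ)‖ := by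
          rw [Real.rpow_neg hqpos.le, Real.rpow_add_one hqpos.ne']
          field_simp
      _ ≤ _ := by gcongr

theorem mem_excSetAll_iff_not_smallDenominatorCondition (α β : ℂ) :
    β / α ∈ excSetAll ↔ ¬ ∃ K > 0, ∃ v > 0, SmallDenominatorCondition α β K v := by
  constructor
  · rintro h ⟨K, hK, v, hv, hS⟩
    exact not_smallDenominatorCondition h hK hv hS
  · intro h
    rw [excSetAll_eq_compl]
    rintro ⟨K, hK, v, hv, hD⟩
    exact h ⟨_, by positivity, v, hv, hD.smallDenominatorCondition hK hv⟩

/-! ### Upper bound for the dimension -/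

instance GaussianInt.instCountable : Countable GaussianInt :=
  Function.Injective.countable (f := fun q : GaussianInt => (q.re, q.im)) fun _ _ h =>
    Zsqrtd.ext (Prod.ext_iff.mp h).1 (Prod.ext_iff.mp h).2

open MeasureTheory ENNReal in
theorem hausdorffMeasure_excSet_inter_ball_ne_top {v s : ℝ} (hv : 0 < v) (hs : 4 < (v + 1) * s)
    (R : ℕ) : μH[s] (excSet v ∩ Metric.ball 0 R) ≠ ∞ := by
  have hs0 : 0 < s := by
    by_contra! h
    nlinarith
  set b := (v + 1) * s / 2 with hb
  have hb2 : 2 < b := by rw [hb]; linarith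
  set A : ℝ := R + 2 with hA
  -- The side conditions sit inside the set, so unwanted pairs give the empty set and the sum can
  -- run over all pairs.
  let t : ℕ → GaussianInt × GaussianInt → Set ℂ := fun n pq =>
    {z | ‖z - (pq.1 : ℂ) / pq.2‖ < 1 / ‖(pq.2 : ℂ)‖ ^ (v + 1) ∧ pq.2 ≠ 0 ∧ (n : ℝ) < ‖(pq.2 : ℂ)‖ ∧
      ‖(pq.1 : ℂ)‖ + 1 ≤ A * ‖(pq.2 : ℂ)‖}
  let f : GaussianInt × GaussianInt → ℝ := fun pq =>
    (2 ^ s * A ^ b) * ((‖(pq.1 : ℂ)‖ + 1) ^ (-b) * ‖(pq.2 : ℂ)‖ ^ (-b))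
  have hf : Summable f := ((GaussianInt.summable_norm_add_one_rpow hb2).mul_of_nonneg
    (GaussianInt.summable_norm_rpow hb2) (fun _ => by positivity) (fun _ => by positivity)).mul_left _
  have hdiam : ∀ n pq, (t n pq).Nonempty → Metric.ediam (t n pq) ≤
      ENNReal.ofReal (2 * ‖(pq.2 : ℂ)‖ ^ (-(v + 1))) := by
    intro n pq _
    refine Metric.ediam_le fun x hx y hy => ?_
    rw [edist_dist]
    refine ENNReal.ofReal_le_ofReal ?_
    have h1 := hx.1
    have h2 := hy.1
    rw [one_div, ← Real.rpow_neg (norm_nonneg _), ← dist_eq_norm] at h1 h2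
    linarith [dist_triangle_right x y ((pq.1 : ℂ) / pq.2)]
  have hterm : ∀ n pq, Metric.ediam (t n pq) ^ s ≤ ENNReal.ofReal (f pq) := by
    intro n pq
    rcases (t n pq).eq_empty_or_nonempty with h | h
    · rw [h, Metric.ediam_empty, ENNReal.zero_rpow_of_pos hs0]
      exact zero_le
    · obtain ⟨z, -, hq, -, hpq⟩ := id h
      have hq1 := GaussianInt.one_le_norm hq
      have hq0 : 0 < ‖(pq.2 : ℂ)‖ := by linarith
      have hA0 : 0 < A := by positivity
      refine (ENNReal.rpow_le_rpow (hdiam n pq h) hs0.le).trans ?_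
      rw [ENNReal.ofReal_rpow_of_nonneg (by positivity) hs0.le]
      refine ENNReal.ofReal_le_ofReal ?_
      -- Instead of counting numerators for each q, half of the exponent 2b is traded for decay in
      -- p, so that the double sum factors.
      have hkey : ‖(pq.2 : ℂ)‖ ^ (-b) ≤ A ^ b * (‖(pq.1 : ℂ)‖ + 1) ^ (-b) := by
        have := Real.rpow_le_rpow_of_nonpos (by positivity) hpq (by linarith : -b ≤ 0)
        rw [Real.mul_rpow hA0.le hq0.le, Real.rpow_neg hA0.le] at this
        rwa [inv_mul_le_iff₀ (by positivity)] at this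
      calc (2 * ‖(pq.2 : ℂ)‖ ^ (-(v + 1))) ^ s
          = 2 ^ s * (‖(pq.2 : ℂ)‖ ^ (-b) * ‖(pq.2 : ℂ)‖ ^ (-b)) := by
            rw [Real.mul_rpow (by norm_num) (by positivity), ← Real.rpow_mul hq0.le,
              ← Real.rpow_add hq0]
            congr 2
            rw [hb]; ring
        _ ≤ 2 ^ s * (A ^ b * (‖(pq.1 : ℂ)‖ + 1) ^ (-b) * ‖(pq.2 : ℂ)‖ ^ (-b)) := by gcongr
        _ = f pq := by simp only [f]; ring
  have hle := Measure.hausdorffMeasure_le_liminf_tsum s (excSet v ∩ Metric.ball 0 R)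
    (l := (atTop : Filter ℕ)) (fun n : ℕ => ENNReal.ofReal (2 * (n : ℝ) ^ (-(v + 1)))) ?_ t ?_ ?_
  · refine ne_top_of_le_ne_top hf.tsum_ofReal_ne_top (hle.trans ?_)
    refine (liminf_le_of_le (by isBoundedDefault) fun c hc => ?_)
    obtain ⟨n, hn⟩ := hc.exists
    exact hn.trans (ENNReal.tsum_le_tsum (hterm n))
  · have h1 := ((tendsto_rpow_neg_atTop (by linarith : 0 < v + 1)).comp
      tendsto_natCast_atTop_atTop).const_mul 2
    simpa using ENNReal.tendsto_ofReal h1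
  · filter_upwards [eventually_ge_atTop 1] with n hn pq
    rcases (t n pq).eq_empty_or_nonempty with h | h
    · rw [h, Metric.ediam_empty]
      exact zero_le
    · obtain ⟨z, -, hq, hnq, hpq⟩ := id h
      refine (hdiam n pq h).trans (ENNReal.ofReal_le_ofReal ?_)
      have hn' : (0 : ℝ) < n := by exact_mod_cast hn
      exact mul_le_mul_of_nonneg_left
        (Real.rpow_le_rpow_of_nonpos hn' hnq.le (by linarith)) (by norm_num)
  · refine Eventually.of_forall fun n z hz => ?_
    obtain ⟨p, q, hq, hn, hlt⟩ := exists_large_denominator hv (excSet_subset_approxSet v hz.1) n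
    refine Set.mem_iUnion.mpr ⟨(p, q), hlt, hq, hn, ?_⟩
    have hq1 := GaussianInt.one_le_norm hq
    have hzR : ‖z‖ < R := by simpa using hz.2
    have h1 : ‖z - (p : ℂ) / q‖ ≤ 1 := hlt.le.trans
      (div_le_one_of_le₀ (Real.one_le_rpow hq1 (by linarith)) (by positivity))
    have h2 : ‖(p : ℂ) / q‖ ≤ R + 1 := by
      have := norm_sub_norm_le ((p : ℂ) / q) z
      rw [norm_sub_rev] at this
      linarith
    rw [norm_div, div_le_iff₀ (by linarith)] at h2
    show ‖(p : ℂ)‖ + 1 ≤ A * ‖(q : ℂ)‖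
    rw [hA]; nlinarith

theorem dimH_excSet_le {v : ℝ} (hv : 0 < v) : dimH (excSet v) ≤ ENNReal.ofReal (4 / (v + 1)) := by
  have hcover : excSet v = ⋃ R : ℕ, excSet v ∩ Metric.ball 0 R := by
    rw [← Set.inter_iUnion, Metric.iUnion_ball_nat, Set.inter_univ]
  rw [hcover, dimH_iUnion]
  refine iSup_le fun R => ?_
  refine le_of_forall_gt_imp_ge_of_dense fun c hc => ?_
  rcases eq_or_ne c ⊤ with rfl | hct
  · exact le_top
  lift c to NNReal using hct
  refine dimH_le_of_hausdorffMeasure_ne_top (hausdorffMeasure_excSet_inter_ball_ne_top hv ?_ R)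
  rw [ENNReal.ofReal_lt_iff_lt_toReal (by positivity) ENNReal.coe_ne_top, ENNReal.coe_toReal,
    div_lt_iff₀ (by linarith)] at hc
  linarith

/-! ### Counting Gaussian fractions in a disc -/

open MeasureTheory in
/-- Area comparison for a finite cover of a disc by discs. -/
theorem sq_le_sum_sq_of_closedBall_subset {ι : Type*} (F : Finset ι) (y : ι → ℂ) (ρ : ι → ℝ)
    (hρ : ∀ i ∈ F, 0 ≤ ρ i) {x : ℂ} {r : ℝ} (hr : 0 ≤ r)
    (h : Metric.closedBall x r ⊆ ⋃ i ∈ F, Metric.closedBall (y i) (ρ i)) :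
    r ^ 2 ≤ ∑ i ∈ F, ρ i ^ 2 := by
  have h1 := (measure_mono (μ := volume) h).trans (measure_biUnion_finset_le F _)
  simp only [Complex.volume_closedBall] at h1
  rw [← Finset.sum_mul, ENNReal.mul_le_mul_iff_left (by simp [NNReal.pi_ne_zero]) (by simp)] at h1
  have h2 : ∑ i ∈ F, ENNReal.ofReal (ρ i) ^ 2 = ENNReal.ofReal (∑ i ∈ F, ρ i ^ 2) := by
    rw [ENNReal.ofReal_sum_of_nonneg (fun i _ => sq_nonneg _)]
    exact Finset.sum_congr rfl fun i hi => (ENNReal.ofReal_pow (hρ i hi) 2).symm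
  rw [h2, ← ENNReal.ofReal_pow hr] at h1
  exact (ENNReal.ofReal_le_ofReal_iff (Finset.sum_nonneg fun i _ => sq_nonneg _)).mp h1

open MeasureTheory in
/-- Area bound for the number of separated points in a disc. -/
theorem card_mul_sq_le_of_separated {ι : Type*} (S : Finset ι) (f : ι → ℂ) {x : ℂ} {R ρ : ℝ}
    (hR : 0 ≤ R) (hρ : 0 < ρ) (hS : ∀ i ∈ S, f i ∈ Metric.closedBall x R)
    (hsep : ∀ i ∈ S, ∀ j ∈ S, i ≠ j → ρ ≤ dist (f i) (f j)) :
    (S.card : ℝ) * ρ ^ 2 ≤ 4 * (R + ρ / 2) ^ 2 := by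
  have hdisj : (S : Set ι).PairwiseDisjoint fun i => Metric.ball (f i) (ρ / 2) := by
    intro i hi j hj hij
    refine Metric.ball_disjoint_ball ?_
    linarith [hsep i hi j hj hij]
  have hsub : (⋃ i ∈ S, Metric.ball (f i) (ρ / 2)) ⊆ Metric.closedBall x (R + ρ / 2) := by
    refine Set.iUnion₂_subset fun i hi => ?_
    refine Metric.ball_subset_closedBall.trans (Metric.closedBall_subset_closedBall' ?_)
    linarith [Metric.mem_closedBall.mp (hS i hi)]
  have h1 := measure_mono (μ := volume) hsub
  rw [measure_biUnion_finset hdisj fun i _ => measurableSet_ball] at h1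
  simp only [Complex.volume_closedBall, Complex.volume_ball] at h1
  rw [← Finset.sum_mul, ENNReal.mul_le_mul_iff_left (by simp [NNReal.pi_ne_zero]) (by simp),
    Finset.sum_const, nsmul_eq_mul, ← ENNReal.ofReal_pow (by positivity),
    ← ENNReal.ofReal_pow (by positivity), ← ENNReal.ofReal_natCast,
    ← ENNReal.ofReal_mul (by positivity), ENNReal.ofReal_le_ofReal_iff (by positivity)] at h1
  nlinarith

theorem GaussianInt.card_le_of_mem_closedBall (S : Finset GaussianInt) {x : ℂ} {R : ℝ}
    (hR : 0 ≤ R) (hS : ∀ p ∈ S, (p : ℂ) ∈ Metric.closedBall x R) :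
    (S.card : ℝ) ≤ (2 * R + 1) ^ 2 := by
  have := card_mul_sq_le_of_separated S (fun p : GaussianInt => (p : ℂ)) hR one_pos hS
    fun i _ j _ hij => by
      rw [dist_eq_norm, ← GaussianInt.toComplex_sub]
      exact GaussianInt.one_le_norm (sub_ne_zero.mpr hij)
  nlinarith

/-- Distinct Gaussian fractions repel each other. -/
theorem one_div_le_dist_of_ne {p q p' q' : GaussianInt} (hq : q ≠ 0) (hq' : q' ≠ 0) {Q : ℝ}
    (hQ : ‖(q : ℂ)‖ ≤ Q) (hQ' : ‖(q' : ℂ)‖ ≤ Q) (hne : (p : ℂ) / q ≠ (p' : ℂ) / q') :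
    1 / Q ^ 2 ≤ dist ((p : ℂ) / q) ((p' : ℂ) / q') := by
  have h1 := GaussianInt.one_le_norm hq
  have h1' := GaussianInt.one_le_norm hq'
  have hq0 : (q : ℂ) ≠ 0 := norm_pos_iff.mp (by linarith)
  have hq0' : (q' : ℂ) ≠ 0 := norm_pos_iff.mp (by linarith)
  have heq : (p : ℂ) / q - (p' : ℂ) / q' = ((p * q' - q * p' : GaussianInt) : ℂ) / (q * q') := by
    rw [div_sub_div _ _ hq0 hq0', GaussianInt.toComplex_sub, GaussianInt.toComplex_mul,
      GaussianInt.toComplex_mul]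
  have hnz : p * q' - q * p' ≠ 0 := by
    intro h
    rw [h, GaussianInt.toComplex_zero, zero_div] at heq
    exact hne (sub_eq_zero.mp heq)
  have h2 := GaussianInt.one_le_norm hnz
  rw [dist_eq_norm, heq, norm_div, norm_mul]
  refine div_le_div₀ (by positivity) h2 (by positivity) ?_
  rw [sq]
  have hQ0 : 0 ≤ Q := by linarith
  gcongr

theorem abs_fract_sub_fract_le_of_floor_eq {n : ℕ} (hn : 0 < n) {x y : ℝ}
    (h : ⌊(n : ℝ) * Int.fract x⌋₊ = ⌊(n : ℝ) * Int.fract y⌋₊) :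
    |Int.fract x - Int.fract y| ≤ 1 / n := by
  have hn' : (0 : ℝ) < n := by exact_mod_cast hn
  have hx := Nat.floor_le (mul_nonneg hn'.le (Int.fract_nonneg x))
  have hy := Nat.floor_le (mul_nonneg hn'.le (Int.fract_nonneg y))
  have hx' := Nat.lt_floor_add_one ((n : ℝ) * Int.fract x)
  have hy' := Nat.lt_floor_add_one ((n : ℝ) * Int.fract y)
  rw [h] at hx hx'
  rw [le_div_iff₀ hn', ← abs_of_pos hn', ← abs_mul, abs_le]
  constructor <;> linarith

/-- Dirichlet's theorem for the Gaussian integers. -/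
theorem exists_gaussian_approximation (z : ℂ) {n : ℕ} (hn : 0 < n) :
    ∃ p q : GaussianInt, q ≠ 0 ∧ ‖(q : ℂ)‖ ≤ 2 * n ∧ ‖(q : ℂ) * z - p‖ ≤ 2 / n := by
  have hn' : (0 : ℝ) < n := by exact_mod_cast hn
  let Q : ℕ × ℕ → GaussianInt := fun ab => ⟨ab.1, ab.2⟩
  let w : ℕ × ℕ → ℂ := fun ab => (Q ab : ℂ) * z
  let g : ℕ × ℕ → ℕ × ℕ := fun ab =>
    (⌊(n : ℝ) * Int.fract (w ab).re⌋₊, ⌊(n : ℝ) * Int.fract (w ab).im⌋₊)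
  have hfl : ∀ x : ℝ, ⌊(n : ℝ) * Int.fract x⌋₊ < n := fun x => by
    rw [Nat.floor_lt (mul_nonneg hn'.le (Int.fract_nonneg x))]
    nlinarith [Int.fract_lt_one x]
  -- Pigeonhole: (n+1)² multipliers against n² cells of side 1/n for the fractional parts.
  obtain ⟨a, ha, b, hb, hab, hg⟩ := Finset.exists_ne_map_eq_of_card_lt_of_maps_to
    (s := Finset.range (n + 1) ×ˢ Finset.range (n + 1)) (t := Finset.range n ×ˢ Finset.range n)
    (f := g) (by simp only [Finset.card_product, Finset.card_range]; nlinarith)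
    (fun ab _ => by simp [g, hfl])
  simp only [Finset.mem_product, Finset.mem_range] at ha hb
  refine ⟨⟨⌊(w a).re⌋ - ⌊(w b).re⌋, ⌊(w a).im⌋ - ⌊(w b).im⌋⟩, Q a - Q b, ?_, ?_, ?_⟩
  · intro h
    have h' := sub_eq_zero.mp h
    rw [Zsqrtd.ext_iff] at h'
    simp only [Q, Nat.cast_inj] at h'
    exact hab (Prod.ext h'.1 h'.2)
  · refine (Complex.norm_le_abs_re_add_abs_im _).trans ?_
    have h1 : |((a.1 : ℤ) : ℝ) - ((b.1 : ℤ) : ℝ)| ≤ n := by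
      have : |(a.1 : ℤ) - b.1| ≤ n := by rw [abs_le]; omega
      exact_mod_cast this
    have h2 : |((a.2 : ℤ) : ℝ) - ((b.2 : ℤ) : ℝ)| ≤ n := by
      have : |(a.2 : ℤ) - b.2| ≤ n := by rw [abs_le]; omega
      exact_mod_cast this
    rw [GaussianInt.toComplex_sub, Complex.sub_re, Complex.sub_im]
    simp only [Q, GaussianInt.re_toComplex, GaussianInt.im_toComplex]
    linarith
  · have hg' := Prod.ext_iff.mp hg
    have h1 := abs_fract_sub_fract_le_of_floor_eq hn hg'.1
    have h2 := abs_fract_sub_fract_le_of_floor_eq hn hg'.2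
    refine (Complex.norm_le_abs_re_add_abs_im _).trans ?_
    have hw : ((Q a - Q b : GaussianInt) : ℂ) * z = w a - w b := by
      rw [GaussianInt.toComplex_sub, sub_mul]
    rw [hw, Complex.sub_re, Complex.sub_im, Complex.sub_re, Complex.sub_im,
      GaussianInt.re_toComplex, GaussianInt.im_toComplex]
    have e1 : (w a).re - (w b).re - ((⌊(w a).re⌋ - ⌊(w b).re⌋ : ℤ) : ℝ) =
        Int.fract (w a).re - Int.fract (w b).re := by
      simp only [Int.fract]; push_cast; ring
    have e2 : (w a).im - (w b).im - ((⌊(w a).im⌋ - ⌊(w b).im⌋ : ℤ) : ℝ) =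
        Int.fract (w a).im - Int.fract (w b).im := by
      simp only [Int.fract]; push_cast; ring
    rw [e1, e2]
    calc _ ≤ (1 : ℝ) / n + 1 / n := add_le_add h1 h2
      _ = 2 / n := by ring

/-- For large `n`, a disc of radius `r` contains at least `c n⁴ r²` fractions whose denominators
have absolute value at most `2 n`. -/
theorem exists_many_fractions (x : ℂ) {r : ℝ} (hr : 0 < r) :
    ∀ᶠ n : ℕ in atTop, ∃ S : Finset ℂ,
      (∀ s ∈ S, ∃ p q : GaussianInt, q ≠ 0 ∧ ‖(q : ℂ)‖ ≤ 2 * n ∧ s = (p : ℂ) / q) ∧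
      (∀ s ∈ S, s ∈ Metric.closedBall x (r / 2)) ∧
      (n : ℝ) ^ 4 * r ^ 2 / 1280000 ≤ S.card := by
  classical
  set T := ∑' q : GaussianInt, ‖(q : ℂ)‖ ^ (-3 : ℝ) with hT
  have hT0 : 0 ≤ T := tsum_nonneg fun _ => by positivity
  have hsum := GaussianInt.summable_norm_rpow (b := 3) (by norm_num)
  have hlim : ∀ᶠ n : ℕ in atTop, 8 * T + 8 / r * r ^ 2 ≤ r ^ 2 / 64 * n :=
    ((tendsto_natCast_atTop_atTop (R := ℝ)).const_mul_atTop (by positivity)).eventually_ge_atTop _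
  filter_upwards [eventually_ge_atTop 100, hlim] with n hn hnT
  have hn' : (100 : ℝ) ≤ n := by exact_mod_cast hn
  have hn0 : (0 : ℝ) < n := by linarith
  have hnr : 2 / n ≤ r / 4 := by
    rw [div_le_iff₀ hn0]
    have : 8 / r * r ^ 2 = 8 * r := by field_simp
    nlinarith
  let Qs := (GaussianInt.finite_norm_le (2 * n : ℝ)).toFinset.filter (· ≠ 0)
  have hQs : ∀ q, q ∈ Qs ↔ ‖(q : ℂ)‖ ≤ 2 * n ∧ q ≠ 0 := fun q => by simp [Qs]
  let P : GaussianInt → Finset GaussianInt := fun q =>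
    (GaussianInt.finite_norm_le (‖(q : ℂ)‖ * (‖x‖ + r))).toFinset.filter
      fun p => (p : ℂ) / q ∈ Metric.closedBall x (r / 2)
  have hP : ∀ q ≠ 0, ∀ p, p ∈ P q ↔ (p : ℂ) / q ∈ Metric.closedBall x (r / 2) := by
    intro q hq p
    have hq1 := GaussianInt.one_le_norm hq
    simp only [P, Finset.mem_filter, Set.Finite.mem_toFinset, Set.mem_ofPred_eq, and_iff_right_iff_imp]
    intro h
    have h1 : ‖(p : ℂ) / q‖ ≤ ‖x‖ + r := by
      rw [Metric.mem_closedBall, dist_eq_norm] at h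
      linarith [norm_sub_norm_le ((p : ℂ) / q) x]
    rw [norm_div, div_le_iff₀ (by linarith)] at h1
    linarith
  let S : Finset ℂ := (Qs.sigma P).image fun qp => (qp.2 : ℂ) / qp.1
  let Q₁ : Finset GaussianInt := Qs.filter fun q : GaussianInt => ‖(q : ℂ)‖ ≤ n / 100
  refine ⟨S, ?_, ?_, ?_⟩
  · intro s hs
    obtain ⟨⟨q, p⟩, hqp, rfl⟩ := Finset.mem_image.mp hs
    have hq := (hQs q).mp (Finset.mem_sigma.mp hqp).1
    exact ⟨p, q, hq.2, hq.1, rfl⟩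
  · intro s hs
    obtain ⟨⟨q, p⟩, hqp, rfl⟩ := Finset.mem_image.mp hs
    have hq := (hQs q).mp (Finset.mem_sigma.mp hqp).1
    exact (hP q hq.2 p).mp (Finset.mem_sigma.mp hqp).2
  -- Dirichlet discs with ‖q‖ > n/100 have radius at most 200/n² and are indexed by distinct
  -- fractions; those with smaller q are indexed by pairs and turn out to cover little area.
  have hcov : Metric.closedBall x (r / 4) ⊆ ⋃ i ∈ S.disjSum (Q₁.sigma P),
      Metric.closedBall (Sum.elim id (fun qp : (_ : GaussianInt) × GaussianInt => (qp.2 : ℂ) / qp.1) i)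
        (Sum.elim (fun _ : ℂ => 200 / (n : ℝ) ^ 2)
          (fun qp : (_ : GaussianInt) × GaussianInt => 2 / (‖(qp.1 : ℂ)‖ * n)) i) := by
    intro z hz
    obtain ⟨p, q, hq, hqn, hpq⟩ := exists_gaussian_approximation z (n := n) (by omega)
    have hq1 := GaussianInt.one_le_norm hq
    have hq0 : (q : ℂ) ≠ 0 := norm_pos_iff.mp (by linarith)
    have hdist : dist z ((p : ℂ) / q) ≤ 2 / (‖(q : ℂ)‖ * n) := by
      have : z - (p : ℂ) / q = (q * z - p) / q := by field_simp
      rw [dist_eq_norm, this, norm_div, div_le_iff₀ (by linarith)]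
      refine hpq.trans (le_of_eq ?_)
      field_simp
    have hmem : (p : ℂ) / q ∈ Metric.closedBall x (r / 2) := by
      rw [Metric.mem_closedBall] at hz ⊢
      have h1 : 2 / (‖(q : ℂ)‖ * n) ≤ 2 / n := by
        gcongr
        nlinarith
      linarith [dist_triangle_left ((p : ℂ) / q) x z]
    have hqQ : q ∈ Qs := (hQs q).mpr ⟨hqn, hq⟩
    have hpP : p ∈ P q := (hP q hq p).mpr hmem
    by_cases hsmall : ‖(q : ℂ)‖ ≤ n / 100
    · refine Set.mem_iUnion₂.mpr ⟨Sum.inr ⟨q, p⟩, ?_, hdist⟩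
      rw [Finset.inr_mem_disjSum, Finset.mem_sigma]
      exact ⟨Finset.mem_filter.mpr ⟨hqQ, hsmall⟩, hpP⟩
    · refine Set.mem_iUnion₂.mpr ⟨Sum.inl ((p : ℂ) / q), ?_, ?_⟩
      · rw [Finset.inl_mem_disjSum]
        exact Finset.mem_image.mpr ⟨⟨q, p⟩, Finset.mem_sigma.mpr ⟨hqQ, hpP⟩, rfl⟩
      · refine hdist.trans ?_
        push Not at hsmall
        show 2 / (‖(q : ℂ)‖ * n) ≤ 200 / (n : ℝ) ^ 2
        rw [div_le_div_iff₀ (by positivity) (by positivity)]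
        nlinarith
  have harea := sq_le_sum_sq_of_closedBall_subset _ _ _ (fun i _ => by
    rcases i with i | i <;> simp only [Sum.elim_inl, Sum.elim_inr] <;> positivity)
    (by positivity) hcov
  rw [Finset.sum_disjSum] at harea
  simp only [Sum.elim_inl, Sum.elim_inr, Finset.sum_const, nsmul_eq_mul, Finset.sum_sigma] at harea
  have hcardP : ∀ q ∈ Q₁, ((P q).card : ℝ) ≤ 2 * ‖(q : ℂ)‖ ^ 2 * r ^ 2 + 2 := by
    intro q hq
    have hq' := ((hQs q).mp (Finset.mem_filter.mp hq).1).2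
    have hq1 := GaussianInt.one_le_norm hq'
    have hq0 : (q : ℂ) ≠ 0 := norm_pos_iff.mp (by linarith)
    have := GaussianInt.card_le_of_mem_closedBall (P q) (x := q * x) (R := ‖(q : ℂ)‖ * (r / 2))
      (by positivity) fun p hp => by
        have h := (hP q hq' p).mp hp
        rw [Metric.mem_closedBall, dist_eq_norm] at h ⊢
        have : (p : ℂ) - q * x = q * ((p : ℂ) / q - x) := by field_simp
        rw [this, norm_mul]
        gcongr
    nlinarith [sq_nonneg (‖(q : ℂ)‖ * r - 1)]
  have hcardQ : (Q₁.card : ℝ) ≤ (3 / 100 * n) ^ 2 := by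
    refine (GaussianInt.card_le_of_mem_closedBall Q₁ (x := 0) (R := n / 100) (by positivity)
      fun q hq => ?_).trans ?_
    · rw [mem_closedBall_zero_iff]
      exact (Finset.mem_filter.mp hq).2
    · gcongr
      linarith
  have hbad : ∑ q ∈ Q₁, ((P q).card : ℝ) * (2 / (‖(q : ℂ)‖ * n)) ^ 2 ≤
      8 * r ^ 2 * (3 / 100) ^ 2 + 8 * T / n := by
    calc _ ≤ ∑ q ∈ Q₁, (8 * r ^ 2 / (n : ℝ) ^ 2 + 8 / n * ‖(q : ℂ)‖ ^ (-3 : ℝ)) := by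
          refine Finset.sum_le_sum fun q hq => ?_
          have hq' := ((hQs q).mp (Finset.mem_filter.mp hq).1).2
          have hqn := (Finset.mem_filter.mp hq).2
          have hq1 := GaussianInt.one_le_norm hq'
          have hq0 : 0 < ‖(q : ℂ)‖ := by linarith
          have h3 : ‖(q : ℂ)‖ ^ (-3 : ℝ) = (‖(q : ℂ)‖ ^ 3)⁻¹ := by
            rw [Real.rpow_neg hq0.le]; norm_cast
          rw [h3]
          calc _ ≤ (2 * ‖(q : ℂ)‖ ^ 2 * r ^ 2 + 2) * (2 / (‖(q : ℂ)‖ * n)) ^ 2 := by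
                gcongr; exact hcardP q hq
            -- The sum of ‖q‖^(-2) diverges; the spare factor ‖q‖/n ≤ 1 is given up to reach the
            -- convergent exponent -3.
            _ = 8 * r ^ 2 / (n : ℝ) ^ 2 + 8 / n * (‖(q : ℂ)‖ ^ 3)⁻¹ * (‖(q : ℂ)‖ / n) := by
                field_simp; ring
            _ ≤ _ := by
                have : ‖(q : ℂ)‖ / n ≤ 1 := by
                  rw [div_le_one hn0]; linarith
                have h0 : 0 ≤ 8 / n * (‖(q : ℂ)‖ ^ 3)⁻¹ := by positivity
                nlinarith
      _ = Q₁.card * (8 * r ^ 2 / (n : ℝ) ^ 2) + 8 / n * ∑ q ∈ Q₁, ‖(q : ℂ)‖ ^ (-3 : ℝ) := by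
          rw [Finset.sum_add_distrib, Finset.sum_const, nsmul_eq_mul, Finset.mul_sum]
      _ ≤ (3 / 100 * n) ^ 2 * (8 * r ^ 2 / (n : ℝ) ^ 2) + 8 / n * T := by
          gcongr
          exact hsum.sum_le_tsum Q₁ fun _ _ => by positivity
      _ = _ := by field_simp
  have hTn : 8 * T / n ≤ r ^ 2 / 64 := by
    rw [div_le_iff₀ hn0]
    have : 0 ≤ 8 / r * r ^ 2 := by positivity
    linarith
  -- Of the area r²/16, small denominators use at most 0.0072 r² + r²/64, leaving more than r²/32.
  have hmain : r ^ 2 / 32 ≤ S.card * (200 / (n : ℝ) ^ 2) ^ 2 := by nlinarith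
  have he : (S.card : ℝ) * (200 / (n : ℝ) ^ 2) ^ 2 = 40000 * S.card / (n : ℝ) ^ 4 := by
    field_simp; norm_num
  rw [he, le_div_iff₀ (by positivity)] at hmain
  linarith

/-! ### Loads of a covering family and averaging -/

/-- The total weight of those members of the family `U` that meet the closed disc. -/
noncomputable def ballLoad (U : ℕ → Set ℂ) (w : ℕ → ENNReal) (x : ℂ) (r : ℝ) : ENNReal :=
  ∑' i, {i | (U i ∩ Metric.closedBall x r).Nonempty}.indicator w i

theorem le_ballLoad {U : ℕ → Set ℂ} {w : ℕ → ENNReal} {x : ℂ} {r : ℝ} {i : ℕ}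
    (hi : (U i ∩ Metric.closedBall x r).Nonempty) : w i ≤ ballLoad U w x r := by
  have h := ENNReal.le_tsum (f := {i | (U i ∩ Metric.closedBall x r).Nonempty}.indicator w) i
  rwa [Set.indicator_of_mem (show i ∈ {i | (U i ∩ Metric.closedBall x r).Nonempty} from hi)] at h

/-- A set of diameter at most `d` meets few of the small discs centred at separated points. -/
theorem card_meeting_le {S : Finset ℂ} {ρ r' d : ℝ} (hρ : 0 < ρ) (hr' : r' ≤ ρ / 4)
    (hsep : ∀ s ∈ S, ∀ s' ∈ S, s ≠ s' → ρ ≤ dist s s') {V : Set ℂ}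
    (hV : ∀ a ∈ V, ∀ b ∈ V, dist a b ≤ d) (hS : ∀ s ∈ S, (V ∩ Metric.closedBall s r').Nonempty) :
    (d ≤ ρ / 4 → S.card ≤ 1) ∧ (ρ / 4 < d → (S.card : ℝ) ≤ 100 * d ^ 2 / ρ ^ 2) := by
  have hdist : ∀ s ∈ S, ∀ s' ∈ S, dist s s' ≤ d + ρ / 2 := by
    intro s hs s' hs'
    obtain ⟨a, haV, ha⟩ := hS s hs
    obtain ⟨b, hbV, hb⟩ := hS s' hs'
    rw [Metric.mem_closedBall] at ha hb
    have h1 := dist_triangle4 s a b s'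
    rw [dist_comm s a] at h1
    linarith [hV a haV b hbV]
  constructor
  · intro hd
    refine Finset.card_le_one.mpr fun s hs s' hs' => ?_
    by_contra hne
    linarith [hsep s hs s' hs' hne, hdist s hs s' hs']
  · intro hd
    have hd0 : 0 < d := by linarith
    rcases S.eq_empty_or_nonempty with rfl | ⟨s, hs⟩
    · simp only [Finset.card_empty, Nat.cast_zero]
      positivity
    · have h := card_mul_sq_le_of_separated S id (x := s) (R := 3 * d) (by positivity) hρ
        (fun s' hs' => by
          rw [id, Metric.mem_closedBall]
          linarith [hdist s' hs' s hs]) hsep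
      rw [le_div_iff₀ (by positivity)]
      refine h.trans ?_
      have : 3 * d + ρ / 2 ≤ 5 * d := by linarith
      calc 4 * (3 * d + ρ / 2) ^ 2 ≤ 4 * (5 * d) ^ 2 := by gcongr
        _ = 100 * d ^ 2 := by ring

/-- Averaging: if the total truncated load over the discs of radius `r'` is smaller than their
number, then one of them has load at most `θ`. -/
theorem exists_ballLoad_le {U : ℕ → Set ℂ} {w : ℕ → ENNReal} {θ : ENNReal} (hθ0 : θ ≠ 0)
    (hθ : θ ≠ ⊤) {S : Finset ℂ} {r' : ℝ}
    (h : ∑ s ∈ S, ballLoad U (fun i => min 1 (w i / θ)) s r' < S.card) :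
    ∃ s ∈ S, ballLoad U w s r' ≤ θ := by
  have h1 : ∑ s ∈ S, ballLoad U (fun i => min 1 (w i / θ)) s r' < ∑ s ∈ S, (1 : ENNReal) := by
    simpa using h
  obtain ⟨s, hs, hlt⟩ := Finset.exists_lt_of_sum_lt h1
  refine ⟨s, hs, ?_⟩
  -- A truncated load below 1 has every term below 1, so no truncation took place in this disc.
  have heq : ballLoad U (fun i => min 1 (w i / θ)) s r' = ballLoad U w s r' / θ := by
    rw [ballLoad, ballLoad, div_eq_mul_inv, ← ENNReal.tsum_mul_right]
    refine tsum_congr fun i => ?_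
    by_cases hi : (U i ∩ Metric.closedBall s r').Nonempty
    · have hi' : i ∈ {i | (U i ∩ Metric.closedBall s r').Nonempty} := hi
      rw [Set.indicator_of_mem hi', Set.indicator_of_mem hi', ← div_eq_mul_inv]
      have := (le_ballLoad (w := fun i => min 1 (w i / θ)) hi).trans_lt hlt
      refine min_eq_right ?_
      by_contra! hc
      rw [min_eq_left hc.le] at this
      exact lt_irrefl _ this
    · have hi' : i ∉ {i | (U i ∩ Metric.closedBall s r').Nonempty} := hi
      rw [Set.indicator_of_notMem hi', Set.indicator_of_notMem hi', zero_mul]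
  rw [heq] at hlt
  simpa using (ENNReal.div_le_iff hθ0 hθ).mp hlt.le

/-- Interchanging the sums counts each `U i` once per small disc that it meets; a set missing the
large disc meets none. -/
theorem sum_ballLoad_le {U : ℕ → Set ℂ} {g w : ℕ → ENNReal} {S : Finset ℂ} {x : ℂ} {r r' : ℝ}
    {A : ENNReal} (hsub : ∀ s ∈ S, Metric.closedBall s r' ⊆ Metric.closedBall x r)
    (hA : ∀ i, (U i ∩ Metric.closedBall x r).Nonempty → ∀ S' ⊆ S,
      (∀ s ∈ S', (U i ∩ Metric.closedBall s r').Nonempty) → S'.card * g i ≤ A * w i) :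
    ∑ s ∈ S, ballLoad U g s r' ≤ A * ballLoad U w x r := by
  classical
  simp only [ballLoad]
  rw [← Summable.tsum_finsetSum fun _ _ => ENNReal.summable, ← ENNReal.tsum_mul_left]
  refine ENNReal.tsum_le_tsum fun i => ?_
  have hsum : ∑ s ∈ S, {i | (U i ∩ Metric.closedBall s r').Nonempty}.indicator g i =
      (S.filter fun s => (U i ∩ Metric.closedBall s r').Nonempty).card * g i := by
    rw [← nsmul_eq_mul, ← Finset.sum_const, Finset.sum_filter]
    exact Finset.sum_congr rfl fun s _ => by simp [Set.indicator_apply]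
  rw [hsum]
  by_cases hi : (U i ∩ Metric.closedBall x r).Nonempty
  · have hi' : i ∈ {i | (U i ∩ Metric.closedBall x r).Nonempty} := hi
    rw [Set.indicator_of_mem hi']
    exact hA i hi _ (Finset.filter_subset _ _) fun s hs => (Finset.mem_filter.mp hs).2
  · have hempty : (S.filter fun s => (U i ∩ Metric.closedBall s r').Nonempty) = ∅ :=
      Finset.filter_eq_empty_iff.mpr fun s hs hne =>
        hi (hne.mono (Set.inter_subset_inter_right _ (hsub s hs)))
    rw [hempty]
    simp

/-- A disc of small load contains a much smaller disc of small load centred at a fraction. -/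
theorem exists_fraction_ballLoad_le {s t η : ℝ} (hs0 : 0 < s) (hs2 : s ≤ 2) (ht : 2 < t)
    (hst : t * s < 4) (hη0 : 0 < η) (hη1 : η ≤ 1) (hη : 25600 * η ≤ 1 / 5120000)
    {U : ℕ → Set ℂ} {d : ℕ → ℝ} (hd0 : ∀ i, 0 < d i)
    (hU : ∀ i, ∀ a ∈ U i, ∀ b ∈ U i, dist a b ≤ d i) {x : ℂ} {r : ℝ} (hr : 0 < r)
    (hload : ballLoad U (fun i => ENNReal.ofReal (d i ^ s)) x r ≤ ENNReal.ofReal (η * r ^ s)) :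
    ∀ᶠ n : ℕ in atTop, ∃ p q : GaussianInt, q ≠ 0 ∧ ‖(q : ℂ)‖ ≤ 2 * n ∧
      Metric.closedBall ((p : ℂ) / q) ((n : ℝ) ^ (-t)) ⊆ Metric.closedBall x r ∧
      ballLoad U (fun i => ENNReal.ofReal (d i ^ s)) ((p : ℂ) / q) ((n : ℝ) ^ (-t)) ≤
        ENNReal.ofReal (η * ((n : ℝ) ^ (-t)) ^ s) := by
  have hcast := tendsto_natCast_atTop_atTop (R := ℝ)
  have hev1 : ∀ᶠ n : ℕ in atTop, (n : ℝ) ^ (-t) < r / 2 :=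
    ((tendsto_rpow_neg_atTop (by linarith : 0 < t)).comp hcast).eventually_lt_const (by positivity)
  have hev2 : ∀ᶠ n : ℕ in atTop, (n : ℝ) ^ (-(t - 2)) < 1 / 16 :=
    ((tendsto_rpow_neg_atTop (by linarith : 0 < t - 2)).comp hcast).eventually_lt_const
      (by norm_num)
  have hev3 : ∀ᶠ n : ℕ in atTop, (n : ℝ) ^ (-(4 - t * s)) < r ^ 2 / (5120000 * r ^ s) :=
    ((tendsto_rpow_neg_atTop (by linarith : 0 < 4 - t * s)).comp hcast).eventually_lt_const
      (by positivity)
  filter_upwards [exists_many_fractions x hr, hev1, hev2, hev3, eventually_gt_atTop 0] with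
    n ⟨S, hfrac, hSx, hcard⟩ h1 h2 h3 hn
  have hn0 : (0 : ℝ) < n := by exact_mod_cast hn
  set r' := (n : ℝ) ^ (-t) with hr'
  have hr'0 : 0 < r' := by positivity
  set ρ : ℝ := 1 / (2 * n) ^ 2 with hρ
  have hρ0 : 0 < ρ := by positivity
  have hr'ρ : r' ≤ ρ / 4 := by
    have e : r' = (n : ℝ) ^ (-(t - 2)) * ((n : ℝ) ^ 2)⁻¹ := by
      rw [hr', ← Real.rpow_natCast, ← Real.rpow_neg hn0.le, ← Real.rpow_add hn0]
      congr 1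
      push_cast; ring
    have e2 : ρ / 4 = 1 / 16 * ((n : ℝ) ^ 2)⁻¹ := by rw [hρ]; field_simp; norm_num
    rw [e, e2]
    gcongr
  have hsub : ∀ y ∈ S, Metric.closedBall y r' ⊆ Metric.closedBall x r := fun y hy =>
    Metric.closedBall_subset_closedBall' (by linarith [Metric.mem_closedBall.mp (hSx y hy)])
  have hsep : ∀ y ∈ S, ∀ y' ∈ S, y ≠ y' → ρ ≤ dist y y' := by
    intro y hy y' hy' hne
    obtain ⟨p, q, hq, hqn, rfl⟩ := hfrac y hy
    obtain ⟨p', q', hq', hqn', rfl⟩ := hfrac y' hy'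
    exact one_div_le_dist_of_ne hq hq' hqn hqn' hne
  have hθ : 0 < η * r' ^ s := by positivity
  -- The first term pays for sets of diameter above ρ/4, which meet many discs but count at most 1
  -- in each; the second for smaller sets, which meet at most one.
  set A : ℝ := 100 * r ^ (2 - s) / ρ ^ 2 + 1 / (η * r' ^ s) with hA
  have hA0 : 0 ≤ A := by positivity
  have hbound : ∑ y ∈ S, ballLoad U (fun i => min 1
      (ENNReal.ofReal (d i ^ s) / ENNReal.ofReal (η * r' ^ s))) y r' ≤
      ENNReal.ofReal A * ballLoad U (fun i => ENNReal.ofReal (d i ^ s)) x r := by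
    refine sum_ballLoad_le hsub fun i hi S' hS' hmeet => ?_
    have hdi := hd0 i
    -- One member's weight is at most the whole load, so no set meeting a good disc is larger than
    -- its radius.
    have hdr : d i ≤ r := by
      have hle := (le_ballLoad (w := fun i => ENNReal.ofReal (d i ^ s)) hi).trans hload
      rw [ENNReal.ofReal_le_ofReal_iff (by positivity)] at hle
      refine (Real.rpow_le_rpow_iff hdi.le hr.le hs0).mp (hle.trans ?_)
      exact mul_le_of_le_one_left (by positivity) hη1
    obtain ⟨hsm, hlg⟩ := card_meeting_le hρ0 hr'ρ
      (fun a ha b hb => hsep a (hS' ha) b (hS' hb)) (hU i) hmeet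
    rw [← ENNReal.ofReal_mul hA0]
    rcases le_or_gt (d i) (ρ / 4) with hc | hc
    · calc (S'.card : ENNReal) * min 1 (ENNReal.ofReal (d i ^ s) / ENNReal.ofReal (η * r' ^ s))
          ≤ 1 * (ENNReal.ofReal (d i ^ s) / ENNReal.ofReal (η * r' ^ s)) :=
            mul_le_mul' (by exact_mod_cast hsm hc) (min_le_right _ _)
        _ = ENNReal.ofReal (d i ^ s / (η * r' ^ s)) := by
            rw [one_mul, ENNReal.ofReal_div_of_pos hθ]
        _ ≤ _ := by
            refine ENNReal.ofReal_le_ofReal ?_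
            rw [hA, add_mul, div_eq_mul_one_div, mul_comm (d i ^ s)]
            exact le_add_of_nonneg_left (by positivity)
    · calc (S'.card : ENNReal) * min 1 (ENNReal.ofReal (d i ^ s) / ENNReal.ofReal (η * r' ^ s))
          ≤ S'.card * 1 := mul_le_mul' le_rfl (min_le_left _ _)
        _ = ENNReal.ofReal (S'.card : ℝ) := by rw [mul_one, ENNReal.ofReal_natCast]
        _ ≤ _ := by
            refine ENNReal.ofReal_le_ofReal ((hlg hc).trans ?_)
            have e : d i ^ 2 = d i ^ (2 - s) * d i ^ s := by
              rw [← Real.rpow_add hdi, sub_add_cancel]; norm_cast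
            calc 100 * d i ^ 2 / ρ ^ 2 = 100 * d i ^ (2 - s) / ρ ^ 2 * d i ^ s := by
                  rw [e]; ring
              _ ≤ 100 * r ^ (2 - s) / ρ ^ 2 * d i ^ s := by
                  have : d i ^ (2 - s) ≤ r ^ (2 - s) :=
                    Real.rpow_le_rpow hdi.le hdr (by linarith)
                  gcongr
              _ ≤ A * d i ^ s := by
                  rw [hA, add_mul]
                  exact le_add_of_nonneg_right (by positivity)
  -- The first part of A contributes 1600 η n⁴r², small by the choice of η; the second contributes
  -- r^s n^(ts), which is o(n⁴) because ts < 4.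
  have hlt : A * (η * r ^ s) < S.card := by
    refine lt_of_lt_of_le ?_ hcard
    have e1 : 100 * r ^ (2 - s) / ρ ^ 2 * (η * r ^ s) = 1600 * η * ((n : ℝ) ^ 4 * r ^ 2) := by
      have e : r ^ 2 = r ^ (2 - s) * r ^ s := by
        rw [← Real.rpow_add hr, sub_add_cancel]; norm_cast
      rw [e, hρ]
      field_simp
      ring
    have e2 : 1 / (η * r' ^ s) * (η * r ^ s) = r ^ s * (n : ℝ) ^ 4 * (n : ℝ) ^ (-(4 - t * s)) := by
      have e : (n : ℝ) ^ 4 * (n : ℝ) ^ (-(4 - t * s)) = (r' ^ s)⁻¹ := by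
        rw [hr', ← Real.rpow_mul hn0.le, ← Real.rpow_neg hn0.le, ← Real.rpow_natCast,
          ← Real.rpow_add hn0]
        congr 1
        push_cast; ring
      rw [mul_assoc, e]
      field_simp
    have e3 : r ^ s * (n : ℝ) ^ 4 * (n : ℝ) ^ (-(4 - t * s)) < (n : ℝ) ^ 4 * r ^ 2 / 5120000 := by
      rw [lt_div_iff₀ (by positivity)] at h3
      have : 0 < (n : ℝ) ^ 4 := by positivity
      nlinarith
    have hpos : 0 < (n : ℝ) ^ 4 * r ^ 2 := by positivity
    rw [hA, add_mul, e1, e2]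
    nlinarith
  have htotal : ENNReal.ofReal A * ENNReal.ofReal (η * r ^ s) < S.card := by
    rw [← ENNReal.ofReal_mul hA0, ← ENNReal.ofReal_natCast]
    exact (ENNReal.ofReal_lt_ofReal_iff_of_nonneg (by positivity)).mpr hlt
  obtain ⟨y, hy, hyl⟩ := exists_ballLoad_le (by simpa using hθ) ENNReal.ofReal_ne_top
    ((hbound.trans (mul_le_mul' le_rfl hload)).trans_lt htotal)
  obtain ⟨p, q, hq, hqn, rfl⟩ := hfrac y hy
  exact ⟨p, q, hq, hqn, hsub _ hy, hyl⟩

/-! ### Nested discs and the lower bound for the dimension -/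

/-- A countable family of sets of small total weight does not cover `excSet v`. -/
theorem exists_mem_excSet_forall_notMem {v s t η : ℝ} (hv : v + 1 < t) (hs0 : 0 < s) (hs2 : s ≤ 2)
    (ht : 2 < t) (hst : t * s < 4) (hη0 : 0 < η) (hη1 : η ≤ 1) (hη : 25600 * η ≤ 1 / 5120000)
    (hv0 : 0 < v + 1) {U : ℕ → Set ℂ} {d : ℕ → ℝ} (hd0 : ∀ i, 0 < d i)
    (hU : ∀ i, ∀ a ∈ U i, ∀ b ∈ U i, dist a b ≤ d i)
    (hsum : ∑' i, ENNReal.ofReal (d i ^ s) ≤ ENNReal.ofReal η) :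
    ∃ z ∈ excSet v, ∀ i, z ∉ U i := by
  let w : ℕ → ENNReal := fun i => ENNReal.ofReal (d i ^ s)
  let G := {B : ℂ × ℝ // 0 < B.2 ∧ ballLoad U w B.1 B.2 ≤ ENNReal.ofReal (η * B.2 ^ s)}
  have hstep : ∀ (k : ℕ) (B : G), ∃ B' : G,
      Metric.closedBall B'.1.1 B'.1.2 ⊆ Metric.closedBall B.1.1 B.1.2 ∧
      ∃ (n : ℕ) (p q : GaussianInt), k ≤ n ∧ 0 < n ∧ q ≠ 0 ∧ ‖(q : ℂ)‖ ≤ 2 * n ∧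
        B'.1.1 = (p : ℂ) / q ∧ B'.1.2 = (n : ℝ) ^ (-t) := by
    rintro k ⟨⟨x, r⟩, hr, hB⟩
    obtain ⟨n, ⟨p, q, hq, hqn, hsub, hl⟩, hkn, hn⟩ :=
      ((exists_fraction_ballLoad_le hs0 hs2 ht hst hη0 hη1 hη hd0 hU hr hB).and
        ((eventually_ge_atTop k).and (eventually_gt_atTop 0))).exists
    have hn0 : (0 : ℝ) < n := by exact_mod_cast hn
    exact ⟨⟨((p : ℂ) / q, (n : ℝ) ^ (-t)), by positivity, hl⟩, hsub, n, p, q, hkn, hn, hq, hqn,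
      rfl, rfl⟩
  choose next hnext hfrac using hstep
  have hstart : ballLoad U w 0 1 ≤ ENNReal.ofReal (η * 1 ^ s) := by
    rw [Real.one_rpow, mul_one]
    exact (ENNReal.tsum_le_tsum fun i => Set.indicator_le_self _ _ i).trans hsum
  -- Step k uses some n ≥ k, so the radii n^(-t) tend to zero along the sequence.
  let B : ℕ → G := fun k => Nat.rec ⟨((0 : ℂ), (1 : ℝ)), one_pos, hstart⟩ (fun k b => next k b) k
  have hB : ∀ k, B (k + 1) = next k (B k) := fun _ => rfl
  obtain ⟨z, hz⟩ := IsCompact.nonempty_iInter_of_sequence_nonempty_isCompact_isClosed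
    (fun k => Metric.closedBall (B k).1.1 (B k).1.2)
    (fun k => by rw [hB]; exact hnext k (B k))
    (fun k => Metric.nonempty_closedBall.mpr (B k).2.1.le) (isCompact_closedBall _ _)
    (fun k => Metric.isClosed_closedBall)
  rw [Set.mem_iInter] at hz
  have hcast := tendsto_natCast_atTop_atTop (R := ℝ)
  refine ⟨z, fun K hK => ?_, fun i hi => ?_⟩
  · have hev : ∀ᶠ n : ℕ in atTop, (n : ℝ) ^ (-(t - (v + 1))) < K / 2 ^ (v + 1) :=
      ((tendsto_rpow_neg_atTop (by linarith : 0 < t - (v + 1))).comp hcast).eventually_lt_const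
        (by positivity)
    obtain ⟨k, hk⟩ := hev.exists_forall_of_atTop
    obtain ⟨n, p, q, hkn, hn, hq, hqn, hx, hr⟩ := hfrac k (B k)
    have hn0 : (0 : ℝ) < n := by exact_mod_cast hn
    have hq1 := GaussianInt.one_le_norm hq
    refine ⟨p, q, hq, ?_⟩
    have h1 := hz (k + 1)
    rw [hB, hx, hr, Metric.mem_closedBall, dist_eq_norm] at h1
    refine h1.trans_lt ?_
    rw [lt_div_iff₀ (by positivity)]
    have h2 := hk n hkn
    rw [lt_div_iff₀ (by positivity)] at h2
    refine lt_of_le_of_lt ?_ h2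
    calc (n : ℝ) ^ (-t) * ‖(q : ℂ)‖ ^ (v + 1) ≤ (n : ℝ) ^ (-t) * (2 * n) ^ (v + 1) := by gcongr
      _ = (n : ℝ) ^ (-(t - (v + 1))) * 2 ^ (v + 1) := by
        rw [Real.mul_rpow (by norm_num) hn0.le, mul_left_comm, ← Real.rpow_add hn0, mul_comm]
        congr 2
        ring
  -- If z were in `U i`, the fixed positive weight of `U i` would be at most η r^s for every disc of
  -- the sequence.
  · have hev : ∀ᶠ n : ℕ in atTop, (n : ℝ) ^ (-(t * s)) < d i ^ s / η :=
      ((tendsto_rpow_neg_atTop (by positivity : 0 < t * s)).comp hcast).eventually_lt_const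
        (by have := hd0 i; positivity)
    obtain ⟨k, hk⟩ := hev.exists_forall_of_atTop
    obtain ⟨n, p, q, hkn, hn, hq, hqn, hx, hr⟩ := hfrac k (B k)
    have hn0 : (0 : ℝ) < n := by exact_mod_cast hn
    have h1 := (le_ballLoad (w := w) ⟨z, hi, hz (k + 1)⟩).trans (B (k + 1)).2.2
    rw [hB, hr, ENNReal.ofReal_le_ofReal_iff (by positivity), ← Real.rpow_mul hn0.le] at h1
    have h2 := hk n hkn
    rw [lt_div_iff₀ hη0] at h2
    rw [neg_mul] at h1
    linarith

open MeasureTheory in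
theorem hausdorffMeasure_excSet_ne_zero {v s : ℝ} (hv : 1 ≤ v) (hs0 : 0 < s)
    (hs : (v + 1) * s < 4) : μH[s] (excSet v) ≠ 0 := by
  intro h0
  -- Here v ≥ 1 enters: s ≤ 2 keeps the exponent 2 - s nonnegative in the count of large sets.
  have hs2 : s ≤ 2 := by nlinarith
  obtain ⟨t, hvt, hts⟩ : ∃ t, v + 1 < t ∧ t < 4 / s :=
    exists_between ((lt_div_iff₀ hs0).mpr hs)
  rw [lt_div_iff₀ hs0] at hts
  let η : ℝ := 1 / (25600 * 5120000)
  have hη0 : 0 < η := by norm_num [η]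
  rw [Measure.hausdorffMeasure_apply] at h0
  have h1 := (ENNReal.iSup_eq_zero.mp (ENNReal.iSup_eq_zero.mp h0 1)) one_pos
  have h2 : _ < ENNReal.ofReal (η / 2) := h1.trans_lt (by simpa using hη0)
  simp only [iInf_lt_iff] at h2
  obtain ⟨U, hcov, hdiam, hsum⟩ := h2
  have hfin : ∀ i, Metric.ediam (U i) ≠ ⊤ := fun i => ne_top_of_le_ne_top (by simp) (hdiam i)
  -- Diameters may vanish; padding the weights by a geometric series of sum η/2 makes every d i
  -- positive and keeps the total at most η.
  let d : ℕ → ℝ := fun i => (Metric.diam (U i) ^ s + η / 2 * (1 / 2 / 2 ^ i)) ^ s⁻¹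
  have hds : ∀ i, d i ^ s = Metric.diam (U i) ^ s + η / 2 * (1 / 2 / 2 ^ i) := fun i =>
    Real.rpow_inv_rpow (add_nonneg (Real.rpow_nonneg Metric.diam_nonneg _) (by positivity)) hs0.ne'
  have hd0 : ∀ i, 0 < d i := fun i => Real.rpow_pos_of_pos
    (add_pos_of_nonneg_of_pos (Real.rpow_nonneg Metric.diam_nonneg _) (by positivity)) _
  have hdist : ∀ i, ∀ a ∈ U i, ∀ b ∈ U i, dist a b ≤ d i := by
    intro i a ha b hb
    refine (Metric.dist_le_diam_of_mem' (hfin i) ha hb).trans ?_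
    rw [← Real.rpow_le_rpow_iff Metric.diam_nonneg (hd0 i).le hs0, hds]
    exact le_add_of_nonneg_right (by positivity)
  have hweight : ∑' i, ENNReal.ofReal (d i ^ s) ≤ ENNReal.ofReal η := by
    have hgeo : ∑' i : ℕ, ENNReal.ofReal (η / 2 * (1 / 2 / 2 ^ i)) = ENNReal.ofReal (η / 2) := by
      rw [← ENNReal.ofReal_tsum_of_nonneg (fun i => by positivity)
        ((summable_geometric_two' 1).mul_left _), tsum_mul_left, tsum_geometric_two' 1, mul_one]
    calc ∑' i, ENNReal.ofReal (d i ^ s)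
        = ∑' i, (ENNReal.ofReal (Metric.diam (U i) ^ s) +
            ENNReal.ofReal (η / 2 * (1 / 2 / 2 ^ i))) := tsum_congr fun i => by
          rw [hds, ENNReal.ofReal_add (Real.rpow_nonneg Metric.diam_nonneg _) (by positivity)]
      _ = ∑' i, ENNReal.ofReal (Metric.diam (U i) ^ s) + ENNReal.ofReal (η / 2) := by
          rw [ENNReal.tsum_add, hgeo]
      _ ≤ ENNReal.ofReal (η / 2) + ENNReal.ofReal (η / 2) := by
          gcongr
          refine le_trans (ENNReal.tsum_le_tsum fun i => ?_) hsum.le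
          rcases (U i).eq_empty_or_nonempty with h | h
          · simp [h, Real.zero_rpow hs0.ne']
          · rw [ciSup_pos h, ← ENNReal.ofReal_rpow_of_nonneg Metric.diam_nonneg hs0.le,
              Metric.diam, ENNReal.ofReal_toReal (hfin i)]
      _ = ENNReal.ofReal η := by
          rw [← ENNReal.ofReal_add (by positivity) (by positivity), add_halves]
  obtain ⟨z, hz, hzU⟩ := exists_mem_excSet_forall_notMem hvt hs0 hs2 (by linarith) hts hη0
    (by norm_num [η]) (by norm_num [η]) (by linarith) hd0 hdist hweight
  obtain ⟨i, hi⟩ := Set.mem_iUnion.mp (hcov hz)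
  exact hzU i hi

theorem le_dimH_excSet {v : ℝ} (hv : 1 ≤ v) : ENNReal.ofReal (4 / (v + 1)) ≤ dimH (excSet v) := by
  refine le_of_forall_lt_imp_le_of_dense fun c hc => ?_
  lift c to NNReal using hc.ne_top
  rcases eq_or_ne c 0 with rfl | hc0
  · simp
  refine le_dimH_of_hausdorffMeasure_ne_zero
    (hausdorffMeasure_excSet_ne_zero hv (NNReal.coe_pos.mpr (pos_iff_ne_zero.mpr hc0)) ?_)
  rw [ENNReal.lt_ofReal_iff_toReal_lt ENNReal.coe_ne_top, ENNReal.coe_toReal,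
    lt_div_iff₀ (by linarith)] at hc
  linarith

/-! ### Values of the dimensions -/

theorem dimH_excSet {v : ℝ} (hv : 1 ≤ v) : dimH (excSet v) = ENNReal.ofReal (4 / (v + 1)) :=
  le_antisymm (dimH_excSet_le (by linarith)) (le_dimH_excSet hv)

theorem tendsto_dimH_excSet : Tendsto (fun v : ℝ => dimH (excSet v)) atTop (𝓝 0) := by
  have h : Tendsto (fun v : ℝ => ENNReal.ofReal (4 / (v + 1))) atTop (𝓝 0) := by
    simpa using ENNReal.tendsto_ofReal
      ((tendsto_atTop_add_const_right atTop (1 : ℝ) tendsto_id).const_div_atTop 4)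
  refine h.congr' ?_
  filter_upwards [eventually_ge_atTop 1] with v hv using (dimH_excSet hv).symm

theorem dimH_excSetAll : dimH excSetAll = 0 := by
  refine le_antisymm (ge_of_tendsto tendsto_dimH_excSet ?_) zero_le
  filter_upwards [eventually_gt_atTop 1] with v hv
  exact dimH_mono (Set.iInter₂_subset v hv)

theorem mainTheorem6 :
    (∀ v : ℝ, 0 < v → ∀ ε : ℝ, 0 < ε →
      approxSet (v + ε) ⊆ excSet v ∧ excSet v ⊆ approxSet v) ∧
    (∀ v : ℝ, 1 ≤ v → dimH (excSet v) = ENNReal.ofReal (4 / (v + 1))) ∧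
    excSetAll = {z : ℂ | ∃ K > 0, ∃ v > 0, IsDiophantineType K v z}ᶜ ∧
    (∀ α β : ℂ, α ≠ 0 → β ≠ 0 →
      (β / α ∈ excSetAll ↔ ¬ ∃ K > 0, ∃ v > 0, SmallDenominatorCondition α β K v)) ∧
    Tendsto (fun v : ℝ => dimH (excSet v)) atTop (𝓝 (dimH excSetAll)) ∧
    dimH excSetAll = 0 := by
  refine ⟨fun v hv ε hε => ⟨approxSet_subset_excSet hv hε, excSet_subset_approxSet v⟩,
    fun v hv => dimH_excSet hv, excSetAll_eq_compl,
    fun α β _ _ => mem_excSetAll_iff_not_smallDenominatorCondition α β, ?_, dimH_excSetAll⟩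
  rw [dimH_excSetAll]
  exact tendsto_dimH_excSet
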